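/- A min-max Stackelberg game $(X,Y,f,g)$ consists of nonempty compact sets $X\subset\mathbb R^n$, $Y\subset\mathbb R^m$ and continuous functions $f,g_1,\dots,g_K:X\times Y\to\mathbb R$. Write $V(x)=\max_{y\in Y:\,g(x,y)\ge 0} f(x,y)$ and $V^\star=\min_{x\in X}V(x)$ (the Stackelberg value). For $\varepsilon,\delta\ge 0$, a pair $(x,y)\in X\times Y$ with $g(x,y)\ge 0$ is an $(\varepsilon,\delta)$-Stackelberg equilibrium if $V(x)-\delta\le f(x,y)\le V^\star+\varepsilon$. Assume that $X$ is convex and that: 1. (Slater) for every $x\in X$ there is $\hat y\in Y$ with $g_k(x,\hat y)>0$ for all $k$; 2. the gradients $\nabla_x f,\nabla_x g_1,\dots,\nabla_x g_K$ (relative to $X$) exist and are continuous on $X\times Y$; 3. $f$ is convex in $x$ and concave in $y$, and for every $k$ the function $\mu g_k(x,y)$ is convex in $(\mu,x)$ on $\mathbb R_+\times X$ for every $y\in Y$, and concave in $y$ for every $x\in X$ and $\mu\ge0$. Max-oracle gradient descent with accuracy $\delta\ge 0$ and step sizes $\eta_1,\eta_2,\dots$ starts at some $x^{(0)}\in X$.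 At each $x^{(t)}$ an oracle returns some $y^{(t)}\in Y$ with $g(x^{(t)},y^{(t)})\ge 0$ and $f(x^{(t)},y^{(t)})\ge V(x^{(t)})-\delta$; one takes some $\lambda^{(t)}\in\arg\min_{\lambda\in\mathbb R_+^K}\{f(x^{(t)},y^{(t)})+\sum_k\lambda_k g_k(x^{(t)},y^{(t)})\}$ and sets $$x^{(t+1)}=\Pi_X\Big(x^{(t)}-\eta_{t+1}\big[\nabla_x f(x^{(t)},y^{(t)})+\textstyle\sum_k\lambda^{(t)}_k\nabla_x g_k(x^{(t)},y^{(t)})\big]\Big),$$ where $\Pi_X$ is the Euclidean projection onto $X$. After $T$ iterations, $y^{(T)}$ is obtained by a last oracle call. For $t\ge1$, a best iterate at time $t$ is a pair $(x_{\rm best}^{(t)},y_{\rm best}^{(t)})\in\arg\min\{f(x^{(k)},y^{(k)}):1\le k\le t\}$. (i) If $\eta_t\ge0$, $\sum_{t\ge 1}\eta_t^2<\infty$ and $\sum_{t\ge 1}\eta_t=\infty$, then there is a $(0,\delta)$-Stackelberg equilibrium $(x^*,y^*)$, so that in particular $V^\star-\delta\le f(x^*,y^*)\le V^\star$, with $$\lim_{T\to\infty}f(x_{\rm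 best}^{(T)},y_{\rm best}^{(T)})=f(x^*,y^*).$$ If $\delta=0$, this holds for every $(0,0)$-Stackelberg equilibrium $(x^*,y^*)$, and the limit is $V^\star$. (ii) There are a constant $C$ and numbers $N(\varepsilon)\in\mathbb N$ with $N(\varepsilon)\le C\varepsilon^{-2}$ for $\varepsilon\in(0,1)$, depending only on the game, such that for all $\varepsilon\in(0,1)$, all $\delta\ge0$ and all $T\ge N(\varepsilon)$: if the algorithm is run for $T$ iterations with the constant step size $\eta_t=\|x^{(0)}-x^*\|/\sqrt T$, where $x^*$ is a minimizer of $V$ over $X$, then there is $T^*$ with $1\le T^*\le T$ such that every best iterate at time $T^*$ is an $(\varepsilon,\delta)$-Stackelberg equilibrium. -/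

import Mathlib

open Set Filter Topology

/-- A min-max Stackelberg game `(X, Y, f, g)`: nonempty compact strategy sets `X ⊆ ℝⁿ`, `Y ⊆ ℝᵐ`,
a continuous objective `f : X × Y → ℝ` and continuous constraints `g₁, …, g_K : X × Y → ℝ`.
Only the values of `f` and `g` on `X × Y` are ever used. -/
structure StackelbergGame (n m K : ℕ) where
  X : Set (EuclideanSpace ℝ (Fin n))
  Y : Set (EuclideanSpace ℝ (Fin m))
  f : EuclideanSpace ℝ (Fin n) → EuclideanSpace ℝ (Fin m) → ℝ
  g : Fin K → EuclideanSpace ℝ (Fin n) → EuclideanSpace ℝ (Fin m) → ℝ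
  X_nonempty : X.Nonempty
  X_compact : IsCompact X
  Y_nonempty : Y.Nonempty
  Y_compact : IsCompact Y
  f_continuous : ContinuousOn (Function.uncurry f) (X ×ˢ Y)
  g_continuous : ∀ k, ContinuousOn (Function.uncurry (g k)) (X ×ˢ Y)

namespace StackelbergGame

variable {n m K : ℕ} (G : StackelbergGame n m K)

/-- The inner player's feasible set `{y ∈ Y : g(x, y) ≥ 0}`. -/
def feasible (x : EuclideanSpace ℝ (Fin n)) : Set (EuclideanSpace ℝ (Fin m)) :=
  {y | y ∈ G.Y ∧ ∀ k, 0 ≤ G.g k x y}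

/-- The outer player's value function `V(x) = max {f(x, y) : y ∈ Y, g(x, y) ≥ 0}`
(the supremum is attained when `x ∈ X` and the feasible set is nonempty). -/
noncomputable def value (x : EuclideanSpace ℝ (Fin n)) : ℝ :=
  sSup (G.f x '' G.feasible x)

/-- The Stackelberg value `min_{x ∈ X} V(x)`. -/
noncomputable def stackelbergValue : ℝ :=
  sInf (G.value '' G.X)

/-- `(x, y)` is an `(ε, δ)`-Stackelberg equilibrium: it is feasible and
`V(x) - δ ≤ f(x, y) ≤ min V + ε`. -/
structure IsStackelbergEq (ε δ : ℝ) (x : EuclideanSpace ℝ (Fin n))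
    (y : EuclideanSpace ℝ (Fin m)) : Prop where
  mem_X : x ∈ G.X
  mem_feasible : y ∈ G.feasible x
  inner_le : G.value x - δ ≤ G.f x y
  outer_le : G.f x y ≤ G.stackelbergValue + ε

/-- Concavity of `h` on a set `S` which need not be convex: the concavity inequality holds
whenever the convex combination lies in `S`. For convex `S` this is `ConcaveOn ℝ S h`. -/
def ConcaveRel (S : Set (EuclideanSpace ℝ (Fin m))) (h : EuclideanSpace ℝ (Fin m) → ℝ) : Prop :=
  ∀ y₁ ∈ S, ∀ y₂ ∈ S, ∀ a b : ℝ, 0 ≤ a → 0 ≤ b → a + b = 1 → a • y₁ + b • y₂ ∈ S →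
    a * h y₁ + b * h y₂ ≤ h (a • y₁ + b • y₂)

theorem concaveRel_iff {S : Set (EuclideanSpace ℝ (Fin m))} (hS : Convex ℝ S)
    (h : EuclideanSpace ℝ (Fin m) → ℝ) : ConcaveRel S h ↔ ConcaveOn ℝ S h := by
  constructor
  · intro H
    refine ⟨hS, fun y₁ h₁ y₂ h₂ a b ha hb hab => ?_⟩
    simpa using H y₁ h₁ y₂ h₂ a b ha hb hab (hS h₁ h₂ ha hb hab)
  · intro H y₁ h₁ y₂ h₂ a b ha hb hab _
    simpa using H.2 h₁ h₂ ha hb hab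

/-- The standing assumptions, where `∇f x y` and `∇g k x y` are the gradients at `x`, relative to
`X`, of `f(·, y)` and of `g_k(·, y)`: Slater's condition; existence and continuity of the
`x`-gradients; `f` is convex in `x` and concave in `y`; `μ g_k(x, y)` is convex in `(μ, x)` on
`ℝ₊ × X` for every `y` and concave in `y` for every `(μ, x)`. -/
structure MainAssumption
    (gradf : EuclideanSpace ℝ (Fin n) → EuclideanSpace ℝ (Fin m) → EuclideanSpace ℝ (Fin n))
    (gradg : Fin K → EuclideanSpace ℝ (Fin n) → EuclideanSpace ℝ (Fin m) →
      EuclideanSpace ℝ (Fin n)) : Prop where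
  slater : ∀ x ∈ G.X, ∃ y ∈ G.Y, ∀ k, 0 < G.g k x y
  gradf_spec : ∀ x ∈ G.X, ∀ y ∈ G.Y,
    HasGradientWithinAt (fun z => G.f z y) (gradf x y) G.X x
  gradg_spec : ∀ k, ∀ x ∈ G.X, ∀ y ∈ G.Y,
    HasGradientWithinAt (fun z => G.g k z y) (gradg k x y) G.X x
  gradf_continuous : ContinuousOn (Function.uncurry gradf) (G.X ×ˢ G.Y)
  gradg_continuous : ∀ k, ContinuousOn (Function.uncurry (gradg k)) (G.X ×ˢ G.Y)
  f_convex : ∀ y ∈ G.Y, ConvexOn ℝ G.X (fun x => G.f x y)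
  f_concave : ∀ x ∈ G.X, ConcaveRel G.Y (G.f x)
  g_convex : ∀ k, ∀ y ∈ G.Y,
    ConvexOn ℝ (Ici (0 : ℝ) ×ˢ G.X)
      (fun p : ℝ × EuclideanSpace ℝ (Fin n) => p.1 * G.g k p.2 y)
  g_concave : ∀ k, ∀ μ : ℝ, 0 ≤ μ → ∀ x ∈ G.X, ConcaveRel G.Y (fun y => μ * G.g k x y)

/-- The Lagrangian `f(x, y) + ∑ₖ λₖ gₖ(x, y)`. -/
noncomputable def lagrangian (x : EuclideanSpace ℝ (Fin n)) (y : EuclideanSpace ℝ (Fin m))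
    (l : Fin K → ℝ) : ℝ :=
  G.f x y + ∑ k, l k * G.g k x y

/-- `l` is an optimal multiplier associated with `(x, y)`:
`l ∈ argmin_{λ ∈ ℝ₊ᴷ} {f(x, y) + ∑ₖ λₖ gₖ(x, y)}`. -/
def IsMultiplier (x : EuclideanSpace ℝ (Fin n)) (y : EuclideanSpace ℝ (Fin m))
    (l : Fin K → ℝ) : Prop :=
  0 ≤ l ∧ ∀ l' : Fin K → ℝ, 0 ≤ l' → G.lagrangian x y l ≤ G.lagrangian x y l'

/-- `y` is an admissible answer of a `δ`-max-oracle at `x`. -/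
def IsOracleAnswer (δ : ℝ) (x : EuclideanSpace ℝ (Fin n)) (y : EuclideanSpace ℝ (Fin m)) : Prop :=
  y ∈ G.feasible x ∧ G.value x - δ ≤ G.f x y

/-- `q` is a Euclidean projection of `p` onto `S`. -/
def IsProjection (S : Set (EuclideanSpace ℝ (Fin n))) (p q : EuclideanSpace ℝ (Fin n)) : Prop :=
  q ∈ S ∧ ∀ z ∈ S, dist p q ≤ dist p z

/-- The sequences `x`, `y`, `l` are produced by max-oracle gradient descent, run for `T` iterations
with step sizes `η 1, …, η T`, from `x 0 ∈ X`. Iteration `t + 1` turns `x t` into `x (t + 1)`; a last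
oracle call yields `y T`. -/
structure IsMOGDRun
    (gradf : EuclideanSpace ℝ (Fin n) → EuclideanSpace ℝ (Fin m) → EuclideanSpace ℝ (Fin n))
    (gradg : Fin K → EuclideanSpace ℝ (Fin n) → EuclideanSpace ℝ (Fin m) →
      EuclideanSpace ℝ (Fin n))
    (δ : ℝ) (η : ℕ → ℝ) (T : ℕ)
    (x : ℕ → EuclideanSpace ℝ (Fin n)) (y : ℕ → EuclideanSpace ℝ (Fin m))
    (l : ℕ → Fin K → ℝ) : Prop where
  init : x 0 ∈ G.X
  oracle : ∀ t ≤ T, G.IsOracleAnswer δ (x t) (y t)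
  multiplier : ∀ t < T, G.IsMultiplier (x t) (y t) (l t)
  step : ∀ t < T, IsProjection G.X
    (x t - η (t + 1) • (gradf (x t) (y t) + ∑ k, l t k • gradg k (x t) (y t))) (x (t + 1))

/-- `(u, v) ∈ argmin {f(x⁽ᵏ⁾, y⁽ᵏ⁾) : k = 1, …, t}` is a best iterate at time `t`. -/
def IsBestIterate (x : ℕ → EuclideanSpace ℝ (Fin n)) (y : ℕ → EuclideanSpace ℝ (Fin m)) (t : ℕ)
    (u : EuclideanSpace ℝ (Fin n)) (v : EuclideanSpace ℝ (Fin m)) : Prop :=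
  (∃ k, 1 ≤ k ∧ k ≤ t ∧ u = x k ∧ v = y k) ∧
    ∀ k, 1 ≤ k → k ≤ t → G.f u v ≤ G.f (x k) (y k)

end StackelbergGame

/-!
Letting `μ → 0` in the joint convexity of `μ g_k(x, y)` in `(μ, x)` shows that `g_k(x, y)` does not
depend on `x`. So all feasible sets coincide, `V` is a maximum of convex functions over a fixed set,
and the multiplier part of the step direction, which need not be bounded, is orthogonal to `X` and
has no influence on the projection. Max-oracle gradient descent is therefore a projected subgradient
method for `V` up to the oracle error: with `D = ‖x⁽⁰⁾ - z‖` and `L` a bound for `‖∇ₓ f‖`,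

  `2 ∑ ηₜ₊₁ ⟪∇ₓ f(x⁽ᵗ⁾, y⁽ᵗ⁾), x⁽ᵗ⁾ - z⟫ ≤ D² + L² ∑ ηₜ₊₁²`,

and the `t`-th inner product is at least `f(x⁽ᵗ⁾, y⁽ᵗ⁾) - V(z)` by convexity. Since the initial pair
is not a candidate for the best iterate, the inner product for `t = 0` is only bounded by `-L D`.
The limit of the best values is attained because the graph of the `δ`-oracle is compact.
-/

section GradientWithin

variable {E : Type*} [NormedAddCommGroup E] [InnerProductSpace ℝ E] [CompleteSpace E]
  {S : Set E} {h : E → ℝ} {s x z : E}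

theorem hasDerivWithinAt_comp_lineMap_of_hasGradientWithinAt (hxz : segment ℝ x z ⊆ S)
    (hs : HasGradientWithinAt h s S x) :
    HasDerivWithinAt (h ∘ AffineMap.lineMap (k := ℝ) x z) (inner ℝ s (z - x)) (Icc 0 1) 0 := by
  have hmaps : MapsTo (AffineMap.lineMap (k := ℝ) x z) (Icc 0 1) S := by
    rwa [mapsTo_iff_image_subset, ← segment_eq_image_lineMap]
  have hfderiv : HasFDerivWithinAt h (InnerProductSpace.toDual ℝ E s) S
      (AffineMap.lineMap (k := ℝ) x z 0) := by
    simpa only [AffineMap.lineMap_apply_zero] using hs.hasFDerivWithinAt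
  exact hfderiv.comp_hasDerivWithinAt 0 AffineMap.hasDerivWithinAt_lineMap hmaps

theorem sub_le_inner_of_convexOn_of_hasGradientWithinAt (hh : ConvexOn ℝ S h) (hx : x ∈ S)
    (hz : z ∈ S) (hs : HasGradientWithinAt h s S x) : h x - h z ≤ inner ℝ s (x - z) := by
  have hmaps : MapsTo (AffineMap.lineMap (k := ℝ) x z) (Icc 0 1) S :=
    fun _ ht => hh.1.lineMap_mem hx hz ht
  have hconv : ConvexOn ℝ (Icc 0 1) (h ∘ AffineMap.lineMap (k := ℝ) x z) :=
    (hh.comp_affineMap _).subset hmaps (convex_Icc 0 1)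
  have hslope := hconv.le_slope_of_hasDerivWithinAt (by simp) (by simp) one_pos
    (hasDerivWithinAt_comp_lineMap_of_hasGradientWithinAt (hh.1.segment_subset hx hz) hs)
  rw [← neg_sub z x, inner_neg_right]
  simp only [slope_def_field, Function.comp_apply, AffineMap.lineMap_apply_one,
    AffineMap.lineMap_apply_zero, sub_zero, div_one] at hslope
  linarith

theorem inner_eq_zero_of_eqOn_const_of_hasGradientWithinAt {c : ℝ} (hc : ∀ w ∈ S, h w = c)
    (hxz : segment ℝ x z ⊆ S) (hs : HasGradientWithinAt h s S x) : inner ℝ s (z - x) = 0 := by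
  have hconst : EqOn (h ∘ AffineMap.lineMap (k := ℝ) x z) (fun _ => c) (Icc 0 1) := fun t ht =>
    hc _ (hxz (segment_eq_image_lineMap ℝ x z ▸ mem_image_of_mem _ ht))
  have hzero : (0 : ℝ) ∈ Icc 0 1 := left_mem_Icc.2 zero_le_one
  exact (uniqueDiffOn_Icc_zero_one 0 hzero).eq_deriv _
    (hasDerivWithinAt_comp_lineMap_of_hasGradientWithinAt hxz hs)
    ((hasDerivWithinAt_const 0 _ c).congr_of_mem hconst hzero)

end GradientWithin

theorem eq_of_convexOn_fst_mul {E : Type*} [AddCommGroup E] [Module ℝ E] [TopologicalSpace E]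
    [IsTopologicalAddGroup E] [ContinuousSMul ℝ E] {S : Set E} {φ : E → ℝ} (hφ : ContinuousOn φ S)
    (hconv : ConvexOn ℝ (Ici (0 : ℝ) ×ˢ S) fun p : ℝ × E => p.1 * φ p.2) {x z : E} (hx : x ∈ S)
    (hz : z ∈ S) : φ x = φ z := by
  have hS : Convex ℝ S := fun a ha b hb s t hs ht hst =>
    (hconv.1 (x := (0, a)) ⟨self_mem_Ici, ha⟩ (y := (0, b)) ⟨self_mem_Ici, hb⟩ hs ht hst).2
  suffices hle : ∀ x ∈ S, ∀ z ∈ S, φ x ≤ φ z from le_antisymm (hle x hx z hz) (hle z hz x hx)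
  intro x hx z hz
  have hcont : ContinuousOn (fun t : ℝ => φ (AffineMap.lineMap x z t)) (Icc 0 1) :=
    hφ.comp (by fun_prop) fun t ht => hS.lineMap_mem hx hz ht
  have htendsto : Tendsto (fun t : ℝ => φ (AffineMap.lineMap x z t)) (𝓝[>] 0) (𝓝 (φ x)) := by
    simpa only [AffineMap.lineMap_apply_zero] using
      (hcont 0 (left_mem_Icc.2 zero_le_one)).tendsto.mono_left
        (nhdsWithin_le_iff.2 (Icc_mem_nhdsGT zero_lt_one))
  refine le_of_tendsto htendsto ?_
  filter_upwards [Ioo_mem_nhdsGT zero_lt_one] with t ht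
  -- Convexity between `(0, x)` and `(1, z)` reads `t * φ ((1 - t) • x + t • z) ≤ t * φ z`.
  have hcombo := hconv.2 (x := (0, x)) ⟨self_mem_Ici, hx⟩ (y := (1, z))
    ⟨mem_Ici.2 zero_le_one, hz⟩ (sub_nonneg.2 ht.2.le) ht.1.le (sub_add_cancel 1 t)
  simp only [Prod.smul_mk, Prod.mk_add_mk, smul_eq_mul, mul_zero, mul_one, zero_add, zero_mul,
    one_mul] at hcombo
  rw [AffineMap.lineMap_apply_module]
  exact le_of_mul_le_mul_left hcombo ht.1

section ProjectedDescent

variable {E : Type*} [NormedAddCommGroup E] [InnerProductSpace ℝ E] {S : Set E}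

theorem inner_sub_sub_nonpos_of_isMinOn_dist (hS : Convex ℝ S) {p q z : E} (hq : q ∈ S)
    (hmin : IsMinOn (dist p) S q) (hz : z ∈ S) : inner ℝ (p - q) (z - q) ≤ 0 := by
  have : Nonempty S := ⟨⟨q, hq⟩⟩
  refine (norm_eq_iInf_iff_real_inner_le_zero hS hq).1 (le_antisymm ?_ ?_) z hz
  · exact le_ciInf fun w => by simpa only [dist_eq_norm] using isMinOn_iff.1 hmin w w.2
  · exact ciInf_le ⟨0, forall_mem_range.2 fun _ => norm_nonneg _⟩ (⟨q, hq⟩ : S)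

theorem norm_sub_sq_le_of_projected_step (hS : Convex ℝ S) {x q s w z : E} {c : ℝ} (hz : z ∈ S)
    (hw : ∀ v ∈ S, inner ℝ w (v - x) = 0) (hq : q ∈ S)
    (hmin : IsMinOn (dist (x - c • (s + w))) S q) :
    ‖q - z‖ ^ 2 ≤ ‖x - z‖ ^ 2 - 2 * c * inner ℝ s (x - z) + c ^ 2 * ‖s‖ ^ 2 := by
  have hwz : inner ℝ w (z - q) = 0 := by
    rw [← sub_sub_sub_cancel_right z q x, inner_sub_right, hw z hz, hw q hq, sub_zero]
  have hobtuse : inner ℝ (x - c • s - q) (z - q) ≤ 0 := by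
    have hsplit : x - c • (s + w) - q = (x - c • s - q) - c • w := by module
    simpa only [hsplit, inner_sub_left, inner_smul_left, hwz, mul_zero, sub_zero] using
      inner_sub_sub_nonpos_of_isMinOn_dist hS hq hmin hz
  have hpythagoras : ‖q - z‖ ^ 2 ≤ ‖x - c • s - z‖ ^ 2 := by
    rw [← sub_sub_sub_cancel_right (x - c • s) z q, norm_sub_sq_real (x - c • s - q),
      norm_sub_rev q z]
    linarith [sq_nonneg ‖x - c • s - q‖]
  calc ‖q - z‖ ^ 2 ≤ ‖x - z - c • s‖ ^ 2 := by rwa [sub_right_comm]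
    _ = ‖x - z‖ ^ 2 - 2 * c * inner ℝ s (x - z) + c ^ 2 * ‖s‖ ^ 2 := by
      rw [norm_sub_sq_real, inner_smul_right, real_inner_comm, norm_smul, mul_pow,
        Real.norm_eq_abs, sq_abs, mul_assoc]

theorem two_mul_sum_inner_le_of_projected_steps (hS : Convex ℝ S) {T : ℕ} {x s w : ℕ → E}
    {c : ℕ → ℝ} {z : E} (hz : z ∈ S) (hw : ∀ t < T, ∀ v ∈ S, inner ℝ (w t) (v - x t) = 0)
    (hx : ∀ t < T, x (t + 1) ∈ S)
    (hmin : ∀ t < T, IsMinOn (dist (x t - c t • (s t + w t))) S (x (t + 1))) :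
    2 * ∑ t ∈ Finset.range T, c t * inner ℝ (s t) (x t - z) ≤
      ‖x 0 - z‖ ^ 2 + ∑ t ∈ Finset.range T, c t ^ 2 * ‖s t‖ ^ 2 := by
  suffices htelescope : ∀ t ≤ T,
      ‖x t - z‖ ^ 2 + 2 * ∑ i ∈ Finset.range t, c i * inner ℝ (s i) (x i - z) ≤
        ‖x 0 - z‖ ^ 2 + ∑ i ∈ Finset.range t, c i ^ 2 * ‖s i‖ ^ 2 by
    linarith [htelescope T le_rfl, sq_nonneg ‖x T - z‖]
  intro t
  induction t with
  | zero => simp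
  | succ t ih =>
    intro ht
    have hstep := norm_sub_sq_le_of_projected_step hS hz (hw t ht) (hx t ht) (hmin t ht)
    rw [Finset.sum_range_succ, Finset.sum_range_succ]
    linarith [ih (Nat.le_of_succ_le ht)]

end ProjectedDescent

theorem le_mul_one_add_sq_div_of_descent {c D L R : ℝ} (hD : 0 < D) (hL : 0 ≤ L) (hR : 0 < R)
    (hR2 : 2 ≤ R ^ 2)
    (h : 2 * c * (R ^ 2 * (D / R)) ≤
      D ^ 2 + 2 * (D / R) * (L * D + c) + L ^ 2 * (R ^ 2 * (D / R) ^ 2)) :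
    c ≤ D * (1 + L) ^ 2 / R := by
  have hcleared : 2 * c * (R ^ 2 - 1) ≤ D * ((1 + L ^ 2) * R + 2 * L) := by
    field_simp at h
    linarith
  rw [le_div_iff₀ hR]
  by_contra! hlt
  have hc : 0 < c := pos_of_mul_pos_left ((by positivity : 0 ≤ D * (1 + L) ^ 2).trans_lt hlt) hR.le
  have hR1 : 1 ≤ R := by nlinarith
  have hLR : 2 * L ≤ 2 * L * R := le_mul_of_one_le_right (by positivity) hR1
  have : c * R ^ 2 ≤ D * (1 + L) ^ 2 * R := calc
    c * R ^ 2 ≤ 2 * c * (R ^ 2 - 1) := by nlinarith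
    _ ≤ D * ((1 + L ^ 2) * R + 2 * L) := hcleared
    _ ≤ D * ((1 + L ^ 2) * R + 2 * L * R) := by gcongr
    _ = D * (1 + L) ^ 2 * R := by ring
  nlinarith

theorem exists_nat_le_mul_inv_sq_forall_div_sqrt_le (A : ℝ) :
    ∃ N : ℝ → ℕ, (∃ C : ℝ, ∀ ε ∈ Ioo (0 : ℝ) 1, (N ε : ℝ) ≤ C * (ε ^ 2)⁻¹) ∧
      ∀ ε ∈ Ioo (0 : ℝ) 1, ∀ T : ℕ, N ε ≤ T → 2 ≤ T ∧ A / √(T : ℝ) ≤ ε := by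
  refine ⟨fun ε => ⌈(A / ε) ^ 2⌉₊ + 2, ⟨A ^ 2 + 3, fun ε hε => ?_⟩, fun ε hε T hT => ?_⟩
  · have hone : 1 ≤ (ε ^ 2)⁻¹ :=
      (one_le_inv₀ (pow_pos hε.1 2)).2 (pow_le_one₀ hε.1.le hε.2.le)
    calc ((⌈(A / ε) ^ 2⌉₊ + 2 : ℕ) : ℝ) ≤ (A / ε) ^ 2 + 3 := by
          push_cast
          linarith [Nat.ceil_lt_add_one (sq_nonneg (A / ε))]
      _ ≤ A ^ 2 * (ε ^ 2)⁻¹ + 3 * (ε ^ 2)⁻¹ := by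
          rw [div_pow, div_eq_mul_inv]
          linarith
      _ = (A ^ 2 + 3) * (ε ^ 2)⁻¹ := by ring
  · have hT2 : 2 ≤ T := le_of_add_le_right hT
    have hsqrt : A / ε ≤ √(T : ℝ) :=
      Real.le_sqrt_of_sq_le (Nat.ceil_le.1 (le_of_add_le_left hT))
    exact ⟨hT2, (div_le_comm₀ (by positivity) hε.1).2 hsqrt⟩

namespace StackelbergGame

variable {n m K : ℕ} {G : StackelbergGame n m K}

section Value

variable {x : EuclideanSpace ℝ (Fin n)} {y : EuclideanSpace ℝ (Fin m)} {δ : ℝ}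

theorem continuousOn_f (hx : x ∈ G.X) : ContinuousOn (G.f x) G.Y :=
  G.f_continuous.uncurry_left x hx

theorem isCompact_feasible (hx : x ∈ G.X) : IsCompact (G.feasible x) := by
  have hfeasible : G.feasible x = G.Y ∩ ⋂ k, G.Y ∩ G.g k x ⁻¹' Ici 0 := by
    ext y
    simp only [feasible, mem_ofPred_eq, mem_inter_iff, mem_iInter, mem_preimage, mem_Ici]
    exact and_congr_right fun hy => forall_congr' fun _ => (and_iff_right hy).symm
  rw [hfeasible]
  exact G.Y_compact.inter_right (isClosed_iInter fun k =>
    ((G.g_continuous k).uncurry_left x hx).preimage_isClosed_of_isClosed G.Y_compact.isClosed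
      isClosed_Ici)

theorem f_le_value (hx : x ∈ G.X) (hy : y ∈ G.feasible x) : G.f x y ≤ G.value x :=
  le_csSup ((isCompact_feasible hx).bddAbove_image
    ((continuousOn_f hx).mono fun _ hw => hw.1)) (mem_image_of_mem _ hy)

theorem isOracleAnswer_iff (hx : x ∈ G.X) :
    G.IsOracleAnswer δ x y ↔ y ∈ G.feasible x ∧ ∀ w ∈ G.feasible x, G.f x w - δ ≤ G.f x y := by
  refine and_congr_right fun hy =>
    ⟨fun h w hw => (sub_le_sub_right (f_le_value hx hw) δ).trans h, fun h => ?_⟩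
  rw [sub_le_iff_le_add]
  exact csSup_le ⟨_, mem_image_of_mem _ hy⟩
    (forall_mem_image.2 fun w hw => sub_le_iff_le_add.1 (h w hw))

theorem le_stackelbergValue {a : ℝ} (ha : ∀ z ∈ G.X, a ≤ G.value z) : a ≤ G.stackelbergValue :=
  le_csInf (G.X_nonempty.image _) (forall_mem_image.2 ha)

theorem stackelbergValue_le (hne : ∀ z ∈ G.X, (G.feasible z).Nonempty) (hx : x ∈ G.X) :
    G.stackelbergValue ≤ G.value x := by
  obtain ⟨b, hb⟩ := (G.X_compact.prod G.Y_compact).bddBelow_image G.f_continuous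
  refine csInf_le ⟨b, forall_mem_image.2 fun z hz => ?_⟩ (mem_image_of_mem _ hx)
  obtain ⟨y, hy⟩ := hne z hz
  exact (hb (mem_image_of_mem _ (mk_mem_prod hz hy.1))).trans (f_le_value hz hy)

theorem IsStackelbergEq.mono {ε₁ ε₂ : ℝ} (h : G.IsStackelbergEq ε₁ δ x y) (hε : ε₁ ≤ ε₂) :
    G.IsStackelbergEq ε₂ δ x y :=
  { h with outer_le := h.outer_le.trans (add_le_add_right hε _) }

theorem IsStackelbergEq.f_eq_stackelbergValue (hne : ∀ z ∈ G.X, (G.feasible z).Nonempty)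
    (h : G.IsStackelbergEq 0 0 x y) : G.f x y = G.stackelbergValue := by
  linarith [h.inner_le, h.outer_le, stackelbergValue_le hne h.mem_X]

end Value

/-- The constraints do not couple the two players: on `X × Y`, the value `g_k(x, y)` depends only on
`y`, so that the game is a min-max problem over a product of two sets. -/
def Uncoupled (G : StackelbergGame n m K) : Prop :=
  ∀ k, ∀ y ∈ G.Y, ∀ x ∈ G.X, ∀ z ∈ G.X, G.g k x y = G.g k z y

theorem Uncoupled.feasible_eq (hG : G.Uncoupled) {x z : EuclideanSpace ℝ (Fin n)} (hx : x ∈ G.X)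
    (hz : z ∈ G.X) : G.feasible x = G.feasible z := by
  ext y
  exact and_congr_right fun hy => forall_congr' fun k => by rw [hG k y hy x hx z hz]

theorem Uncoupled.isCompact_oracleAnswers (hG : G.Uncoupled) (δ : ℝ) :
    IsCompact {p : EuclideanSpace ℝ (Fin n) × EuclideanSpace ℝ (Fin m) |
      p.1 ∈ G.X ∧ G.IsOracleAnswer δ p.1 p.2} := by
  obtain ⟨z, hz⟩ := G.X_nonempty
  have hcompact : IsCompact (G.X ×ˢ G.feasible z) := G.X_compact.prod (isCompact_feasible hz)
  have hgraph : {p : EuclideanSpace ℝ (Fin n) × EuclideanSpace ℝ (Fin m) |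
      p.1 ∈ G.X ∧ G.IsOracleAnswer δ p.1 p.2} = (G.X ×ˢ G.feasible z) ∩
        ⋂ w ∈ G.feasible z, (G.X ×ˢ G.feasible z) ∩
          (fun p => G.f p.1 p.2 - G.f p.1 w) ⁻¹' Ici (-δ) := by
    ext ⟨x, y⟩
    simp only [mem_ofPred_eq, mem_inter_iff, mem_prod, mem_iInter, mem_preimage, mem_Ici]
    constructor
    · rintro ⟨hx, h⟩
      obtain ⟨hy, h⟩ := (isOracleAnswer_iff hx).1 h
      rw [hG.feasible_eq hx hz] at hy h
      exact ⟨⟨hx, hy⟩, fun w hw => ⟨⟨hx, hy⟩, by linarith [h w hw]⟩⟩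
    · rintro ⟨⟨hx, hy⟩, h⟩
      rw [isOracleAnswer_iff hx, hG.feasible_eq hx hz]
      exact ⟨hx, hy, fun w hw => by linarith [(h w hw).2]⟩
  have hf : ContinuousOn (fun p => G.f p.1 p.2) (G.X ×ˢ G.feasible z) :=
    G.f_continuous.mono (prod_mono_right fun _ hy => hy.1)
  rw [hgraph]
  refine hcompact.inter_right (isClosed_biInter fun w hw => ?_)
  have hfw : ContinuousOn (fun p => G.f p.1 w) (G.X ×ˢ G.feasible z) :=
    (G.f_continuous.uncurry_right w hw.1).comp continuousOn_fst fun p hp => hp.1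
  exact (hf.sub hfw).preimage_isClosed_of_isClosed hcompact.isClosed isClosed_Ici

variable
  {gradf : EuclideanSpace ℝ (Fin n) → EuclideanSpace ℝ (Fin m) → EuclideanSpace ℝ (Fin n)}
  {gradg : Fin K → EuclideanSpace ℝ (Fin n) → EuclideanSpace ℝ (Fin m) →
    EuclideanSpace ℝ (Fin n)}
  {δ L : ℝ} {η : ℕ → ℝ} {T : ℕ} {x : ℕ → EuclideanSpace ℝ (Fin n)}
  {y : ℕ → EuclideanSpace ℝ (Fin m)} {l : ℕ → Fin K → ℝ}

/-- Feasible games with uncoupled constraints and an objective that is convex in `x`, where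
`gradf x y` and `gradg k x y` are `x`-gradients relative to `X`. -/
structure UncoupledAssumption (G : StackelbergGame n m K)
    (gradf : EuclideanSpace ℝ (Fin n) → EuclideanSpace ℝ (Fin m) → EuclideanSpace ℝ (Fin n))
    (gradg : Fin K → EuclideanSpace ℝ (Fin n) → EuclideanSpace ℝ (Fin m) →
      EuclideanSpace ℝ (Fin n)) : Prop where
  feasible_nonempty : ∀ x ∈ G.X, (G.feasible x).Nonempty
  uncoupled : G.Uncoupled
  f_convex : ∀ y ∈ G.Y, ConvexOn ℝ G.X (fun x => G.f x y)
  gradf_spec : ∀ x ∈ G.X, ∀ y ∈ G.Y,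
    HasGradientWithinAt (fun z => G.f z y) (gradf x y) G.X x
  gradg_spec : ∀ k, ∀ x ∈ G.X, ∀ y ∈ G.Y,
    HasGradientWithinAt (fun z => G.g k z y) (gradg k x y) G.X x

/-- `T` iterations of max-oracle gradient descent with arbitrary real multipliers `l t`. -/
structure IsOracleDescent (G : StackelbergGame n m K)
    (gradf : EuclideanSpace ℝ (Fin n) → EuclideanSpace ℝ (Fin m) → EuclideanSpace ℝ (Fin n))
    (gradg : Fin K → EuclideanSpace ℝ (Fin n) → EuclideanSpace ℝ (Fin m) →
      EuclideanSpace ℝ (Fin n))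
    (δ : ℝ) (η : ℕ → ℝ) (T : ℕ) (x : ℕ → EuclideanSpace ℝ (Fin n))
    (y : ℕ → EuclideanSpace ℝ (Fin m)) (l : ℕ → Fin K → ℝ) : Prop where
  init : x 0 ∈ G.X
  oracle : ∀ t ≤ T, G.IsOracleAnswer δ (x t) (y t)
  step : ∀ t < T, IsProjection G.X
    (x t - η (t + 1) • (gradf (x t) (y t) + ∑ k, l t k • gradg k (x t) (y t))) (x (t + 1))

theorem IsMOGDRun.isOracleDescent (hr : G.IsMOGDRun gradf gradg δ η T x y l) :
    G.IsOracleDescent gradf gradg δ η T x y l :=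
  ⟨hr.init, hr.oracle, hr.step⟩

namespace MainAssumption

theorem uncoupled (hG : G.MainAssumption gradf gradg) : G.Uncoupled := fun k y hy _ hx _ hz =>
  eq_of_convexOn_fst_mul ((G.g_continuous k).uncurry_right y hy) (hG.g_convex k y hy) hx hz

theorem uncoupledAssumption (hG : G.MainAssumption gradf gradg) :
    G.UncoupledAssumption gradf gradg where
  feasible_nonempty x hx := (hG.slater x hx).imp fun _ hy => ⟨hy.1, fun k => (hy.2 k).le⟩
  uncoupled := hG.uncoupled
  f_convex := hG.f_convex
  gradf_spec := hG.gradf_spec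
  gradg_spec := hG.gradg_spec

theorem exists_norm_gradf_le (hG : G.MainAssumption gradf gradg) :
    ∃ L : ℝ, ∀ x ∈ G.X, ∀ y ∈ G.Y, ‖gradf x y‖ ≤ L := by
  obtain ⟨L, hL⟩ :=
    (G.X_compact.prod G.Y_compact).exists_bound_of_continuousOn hG.gradf_continuous
  exact ⟨L, fun x hx y hy => hL (x, y) ⟨hx, hy⟩⟩

end MainAssumption

namespace UncoupledAssumption

theorem convex_X (hG : G.UncoupledAssumption gradf gradg) : Convex ℝ G.X :=
  let ⟨y, hy⟩ := G.Y_nonempty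
  (hG.f_convex y hy).1

theorem inner_sum_smul_gradg_eq_zero (hG : G.UncoupledAssumption gradf gradg)
    {x z : EuclideanSpace ℝ (Fin n)} (hx : x ∈ G.X) (hz : z ∈ G.X)
    {y : EuclideanSpace ℝ (Fin m)} (hy : y ∈ G.Y) (l : Fin K → ℝ) :
    inner ℝ (∑ k, l k • gradg k x y) (z - x) = 0 := by
  rw [sum_inner]
  refine Finset.sum_eq_zero fun k _ => ?_
  have horth : inner ℝ (gradg k x y) (z - x) = 0 :=
    inner_eq_zero_of_eqOn_const_of_hasGradientWithinAt
      (fun w hw => hG.uncoupled k y hy w hw x hx) (hG.convex_X.segment_subset hx hz)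
      (hG.gradg_spec k x hx y hy)
  rw [inner_smul_left, horth, mul_zero]

theorem f_sub_value_le_inner (hG : G.UncoupledAssumption gradf gradg)
    {x z : EuclideanSpace ℝ (Fin n)} (hx : x ∈ G.X) (hz : z ∈ G.X)
    {y : EuclideanSpace ℝ (Fin m)} (hy : y ∈ G.feasible x) :
    G.f x y - G.value z ≤ inner ℝ (gradf x y) (x - z) := by
  have hfz : G.f z y ≤ G.value z := f_le_value hz (hG.uncoupled.feasible_eq hx hz ▸ hy)
  have hgrad := sub_le_inner_of_convexOn_of_hasGradientWithinAt (hG.f_convex y hy.1) hx hz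
    (hG.gradf_spec x hx y hy.1)
  linarith

end UncoupledAssumption

namespace IsOracleDescent

theorem mem_X (hr : G.IsOracleDescent gradf gradg δ η T x y l) : ∀ t ≤ T, x t ∈ G.X
  | 0, _ => hr.init
  | t + 1, ht => (hr.step t ht).1

theorem mem_Y (hr : G.IsOracleDescent gradf gradg δ η T x y l) {t : ℕ} (ht : t ≤ T) :
    y t ∈ G.Y :=
  (hr.oracle t ht).1.1

theorem isOracleAnswer_of_isBestIterate (hr : G.IsOracleDescent gradf gradg δ η T x y l)
    {u : EuclideanSpace ℝ (Fin n)} {v : EuclideanSpace ℝ (Fin m)}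
    (h : G.IsBestIterate x y T u v) : u ∈ G.X ∧ G.IsOracleAnswer δ u v := by
  obtain ⟨⟨k, -, hk, rfl, rfl⟩, -⟩ := h
  exact ⟨hr.mem_X k hk, hr.oracle k hk⟩

theorem two_mul_sum_inner_le (hr : G.IsOracleDescent gradf gradg δ η T x y l)
    (hG : G.UncoupledAssumption gradf gradg)
    (hL : ∀ x ∈ G.X, ∀ y ∈ G.Y, ‖gradf x y‖ ≤ L) {z : EuclideanSpace ℝ (Fin n)} (hz : z ∈ G.X) :
    2 * ∑ t ∈ Finset.range T, η (t + 1) * inner ℝ (gradf (x t) (y t)) (x t - z) ≤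
      ‖x 0 - z‖ ^ 2 + L ^ 2 * ∑ t ∈ Finset.range T, η (t + 1) ^ 2 := by
  have hdescent := two_mul_sum_inner_le_of_projected_steps hG.convex_X
    (c := fun t => η (t + 1)) hz
    (fun t ht _ hv => hG.inner_sum_smul_gradg_eq_zero (hr.mem_X t ht.le) hv (hr.mem_Y ht.le) (l t))
    (fun t ht => (hr.step t ht).1) (fun t ht => isMinOn_iff.2 (hr.step t ht).2)
  refine hdescent.trans (add_le_add_right ?_ _)
  rw [Finset.mul_sum]
  refine Finset.sum_le_sum fun t ht => ?_
  have htT : t ≤ T := (Finset.mem_range.1 ht).le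
  rw [mul_comm (L ^ 2)]
  gcongr
  exact hL _ (hr.mem_X t htT) _ (hr.mem_Y htT)

theorem two_mul_mul_sum_le (hr : G.IsOracleDescent gradf gradg δ η T x y l)
    (hG : G.UncoupledAssumption gradf gradg)
    (hL : ∀ x ∈ G.X, ∀ y ∈ G.Y, ‖gradf x y‖ ≤ L) (hη : ∀ t, 0 ≤ η t) (hT : 1 ≤ T)
    {z : EuclideanSpace ℝ (Fin n)} (hz : z ∈ G.X) {c : ℝ}
    (hc : ∀ t, 1 ≤ t → t ≤ T → G.value z + c ≤ G.f (x t) (y t)) :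
    2 * c * ∑ t ∈ Finset.range T, η (t + 1) ≤
      ‖x 0 - z‖ ^ 2 + 2 * η 1 * (L * ‖x 0 - z‖ + c) +
        L ^ 2 * ∑ t ∈ Finset.range T, η (t + 1) ^ 2 := by
  have hdescent := hr.two_mul_sum_inner_le hG hL hz
  obtain ⟨T, rfl⟩ := Nat.exists_eq_add_of_le' hT
  have hinitial : -(L * ‖x 0 - z‖) ≤ inner ℝ (gradf (x 0) (y 0)) (x 0 - z) :=
    neg_le_of_abs_le <| (abs_real_inner_le_norm _ _).trans <| by
      gcongr
      exact hL _ hr.init _ (hr.mem_Y (Nat.zero_le _))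
  have hlater : ∀ t ∈ Finset.range T, η (t + 2) * c ≤
      η (t + 2) * inner ℝ (gradf (x (t + 1)) (y (t + 1))) (x (t + 1) - z) := fun t ht => by
    have ht : t + 1 ≤ T + 1 := by simpa using (Finset.mem_range.1 ht).le
    refine mul_le_mul_of_nonneg_left ?_ (hη _)
    linarith [hc (t + 1) (by simp) ht,
      hG.f_sub_value_le_inner (hr.mem_X _ ht) hz (hr.oracle _ ht).1]
  have hsum := Finset.sum_le_sum hlater
  have hfirst := mul_le_mul_of_nonneg_left hinitial (hη 1)
  rw [← Finset.sum_mul] at hsum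
  rw [Finset.sum_range_succ'] at hdescent ⊢
  linarith

end IsOracleDescent

theorem UncoupledAssumption.le_stackelbergValue_of_le_f (hG : G.UncoupledAssumption gradf gradg)
    (hL : ∀ x ∈ G.X, ∀ y ∈ G.Y, ‖gradf x y‖ ≤ L) (hη : ∀ t, 0 ≤ η t)
    (hsq : Summable fun t => η t ^ 2)
    (hsum : Tendsto (fun T : ℕ => ∑ t ∈ Finset.Icc 1 T, η t) atTop atTop)
    (hr : ∀ T, G.IsOracleDescent gradf gradg δ η T x y l) {p : ℝ}
    (hp : ∀ t, 1 ≤ t → p ≤ G.f (x t) (y t)) : p ≤ G.stackelbergValue := by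
  refine le_stackelbergValue fun z hz => ?_
  by_contra! hlt
  set c := p - G.value z with hc
  have hbound : ∀ T, 1 ≤ T → 2 * c * ∑ t ∈ Finset.Icc 1 T, η t ≤
      ‖x 0 - z‖ ^ 2 + 2 * η 1 * (L * ‖x 0 - z‖ + c) + L ^ 2 * ∑' t, η t ^ 2 := fun T hT => by
    have hpartial : ∑ t ∈ Finset.range T, η (t + 1) ^ 2 ≤ ∑' t, η t ^ 2 := by
      rw [Finset.range_eq_Ico, Finset.sum_Ico_add' (fun t => η t ^ 2)]
      exact hsq.sum_le_tsum _ fun t _ => sq_nonneg _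
    have hdescent := (hr T).two_mul_mul_sum_le hG hL hη hT hz (c := c)
      fun t ht _ => by simpa [hc] using hp t ht
    calc 2 * c * ∑ t ∈ Finset.Icc 1 T, η t = 2 * c * ∑ t ∈ Finset.range T, η (t + 1) := by
          rw [Finset.range_eq_Ico, Finset.sum_Ico_add', zero_add, Finset.Ico_add_one_right_eq_Icc]
      _ ≤ _ := hdescent.trans (by gcongr)
  have hcpos : 0 < 2 * c := by linarith
  obtain ⟨T, hT, hgt⟩ := ((eventually_ge_atTop 1).and
    ((hsum.const_mul_atTop hcpos).eventually_gt_atTop _)).exists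
  exact hgt.not_ge (hbound T hT)

theorem UncoupledAssumption.exists_isStackelbergEq_tendsto
    (hG : G.UncoupledAssumption gradf gradg) (hL : ∀ x ∈ G.X, ∀ y ∈ G.Y, ‖gradf x y‖ ≤ L)
    (hη : ∀ t, 0 ≤ η t) (hsq : Summable fun t => η t ^ 2)
    (hsum : Tendsto (fun T : ℕ => ∑ t ∈ Finset.Icc 1 T, η t) atTop atTop)
    (hr : ∀ T, G.IsOracleDescent gradf gradg δ η T x y l)
    {u : ℕ → EuclideanSpace ℝ (Fin n)} {v : ℕ → EuclideanSpace ℝ (Fin m)}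
    (hb : ∀ t, 1 ≤ t → G.IsBestIterate x y t (u t) (v t)) :
    ∃ xs ys, G.IsStackelbergEq 0 δ xs ys ∧
      Tendsto (fun T => G.f (u T) (v T)) atTop (𝓝 (G.f xs ys)) := by
  have hgraph : IsCompact (Function.uncurry G.f '' {p | p.1 ∈ G.X ∧ G.IsOracleAnswer δ p.1 p.2}) :=
    (hG.uncoupled.isCompact_oracleAnswers δ).image_of_continuousOn
      (G.f_continuous.mono fun _ hp => ⟨hp.1, hp.2.1.1⟩)
  have hmem : ∀ t, G.f (u (t + 1)) (v (t + 1)) ∈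
      Function.uncurry G.f '' {p | p.1 ∈ G.X ∧ G.IsOracleAnswer δ p.1 p.2} := fun t =>
    ⟨(_, _), (hr (t + 1)).isOracleAnswer_of_isBestIterate (hb (t + 1) (by simp)), rfl⟩
  have hanti : Antitone fun t => G.f (u (t + 1)) (v (t + 1)) := antitone_nat_of_succ_le fun t => by
    obtain ⟨⟨k, hk1, hk, hu, hv⟩, -⟩ := hb (t + 1) (by simp)
    rw [hu, hv]
    exact (hb (t + 1 + 1) (by simp)).2 k hk1 (Nat.le_succ_of_le hk)
  have hbdd : BddBelow (range fun t => G.f (u (t + 1)) (v (t + 1))) :=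
    hgraph.bddBelow.mono (range_subset_iff.2 hmem)
  have hlim := tendsto_atTop_ciInf hanti hbdd
  obtain ⟨⟨xs, ys⟩, ⟨hxs, hys⟩, hf : G.f xs ys = _⟩ :=
    hgraph.isClosed.mem_of_tendsto hlim (.of_forall hmem)
  rw [← hf] at hlim
  refine ⟨xs, ys, ⟨hxs, hys.1, hys.2, ?_⟩, (tendsto_add_atTop_iff_nat 1).1 hlim⟩
  rw [add_zero]
  refine hG.le_stackelbergValue_of_le_f hL hη hsq hsum hr fun t ht => ?_
  obtain ⟨t, rfl⟩ := Nat.exists_eq_add_of_le' ht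
  exact (hanti.le_of_tendsto hlim t).trans ((hb _ ht).2 _ ht le_rfl)

theorem IsOracleDescent.le_value_add_div_sqrt {z : EuclideanSpace ℝ (Fin n)}
    (hr : G.IsOracleDescent gradf gradg δ (fun _ => ‖x 0 - z‖ / √T) T x y l)
    (hG : G.UncoupledAssumption gradf gradg) (hL : ∀ x ∈ G.X, ∀ y ∈ G.Y, ‖gradf x y‖ ≤ L)
    (hT : 2 ≤ T) (hz : z ∈ G.X) {p : ℝ} (hp : ∀ t, 1 ≤ t → t ≤ T → p ≤ G.f (x t) (y t)) :
    p ≤ G.value z + ‖x 0 - z‖ * (1 + L) ^ 2 / √T := by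
  have hT1 : 1 ≤ T := one_le_two.trans hT
  rcases eq_or_ne (x 0) z with h0 | h0
  · have hx1 : x 1 = z := by
      have hproj := (hr.step 0 hT1).2 z hz
      simp only [h0, sub_self, norm_zero, zero_div, zero_smul, sub_zero, zero_add, dist_self]
        at hproj
      exact (dist_le_zero.1 hproj).symm
    calc p ≤ G.f (x 1) (y 1) := hp 1 le_rfl hT1
      _ ≤ G.value (x 1) := f_le_value (hx1 ▸ hz) (hr.oracle 1 hT1).1
      _ = G.value z + ‖x 0 - z‖ * (1 + L) ^ 2 / √T := by simp [hx1, h0]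
  set D := ‖x 0 - z‖
  set R := √(T : ℝ)
  have hD : 0 < D := norm_pos_iff.2 (sub_ne_zero.2 h0)
  have hL0 : 0 ≤ L := (norm_nonneg _).trans (hL _ hr.init _ (hr.mem_Y (Nat.zero_le T)))
  have hRsq : R ^ 2 = T := Real.sq_sqrt T.cast_nonneg
  have hT2 : 2 ≤ R ^ 2 := by rw [hRsq]; exact_mod_cast hT
  have hR : 1 ≤ R := Real.one_le_sqrt.2 (by exact_mod_cast hT1)
  have hdescent := hr.two_mul_mul_sum_le hG hL (fun _ => by positivity) hT1 hz
    (c := p - G.value z) (by simpa using hp)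
  simp only [Finset.sum_const, Finset.card_range, nsmul_eq_mul, ← hRsq] at hdescent
  exact sub_le_iff_le_add'.1 (le_mul_one_add_sq_div_of_descent hD hL0 (by linarith) hT2 hdescent)

theorem IsOracleDescent.isStackelbergEq_of_isBestIterate {xs : EuclideanSpace ℝ (Fin n)}
    (hr : G.IsOracleDescent gradf gradg δ (fun _ => ‖x 0 - xs‖ / √T) T x y l)
    (hG : G.UncoupledAssumption gradf gradg) (hL : ∀ x ∈ G.X, ∀ y ∈ G.Y, ‖gradf x y‖ ≤ L)
    (hT : 2 ≤ T) (hxs : xs ∈ G.X) (hmin : ∀ z ∈ G.X, G.value xs ≤ G.value z)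
    {u : EuclideanSpace ℝ (Fin n)} {v : EuclideanSpace ℝ (Fin m)}
    (hb : G.IsBestIterate x y T u v) :
    G.IsStackelbergEq (‖x 0 - xs‖ * (1 + L) ^ 2 / √T) δ u v := by
  obtain ⟨hu, hv⟩ := hr.isOracleAnswer_of_isBestIterate hb
  exact ⟨hu, hv.1, hv.2, (hr.le_value_add_div_sqrt hG hL hT hxs hb.2).trans
    (add_le_add_left (le_stackelbergValue hmin) _)⟩

end StackelbergGame

theorem mainTheorem2_general {n m K : ℕ} (G : StackelbergGame n m K)
    {gradf : EuclideanSpace ℝ (Fin n) → EuclideanSpace ℝ (Fin m) → EuclideanSpace ℝ (Fin n)}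
    {gradg : Fin K → EuclideanSpace ℝ (Fin n) → EuclideanSpace ℝ (Fin m) →
      EuclideanSpace ℝ (Fin n)}
    (hG : G.UncoupledAssumption gradf gradg) {L : ℝ}
    (hL : ∀ x ∈ G.X, ∀ y ∈ G.Y, ‖gradf x y‖ ≤ L) :
    (∀ (δ : ℝ) (η : ℕ → ℝ), (∀ t, 0 ≤ η t) → Summable (fun t => η t ^ 2) →
      Tendsto (fun T : ℕ => ∑ t ∈ Finset.Icc 1 T, η t) atTop atTop →
      ∀ (x : ℕ → EuclideanSpace ℝ (Fin n)) (y : ℕ → EuclideanSpace ℝ (Fin m))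
        (l : ℕ → Fin K → ℝ), (∀ T, G.IsOracleDescent gradf gradg δ η T x y l) →
      ∀ (u : ℕ → EuclideanSpace ℝ (Fin n)) (v : ℕ → EuclideanSpace ℝ (Fin m)),
        (∀ t, 1 ≤ t → G.IsBestIterate x y t (u t) (v t)) →
      (∃ xs ys, G.IsStackelbergEq 0 δ xs ys ∧
        G.stackelbergValue - δ ≤ G.f xs ys ∧ G.f xs ys ≤ G.stackelbergValue ∧
        Tendsto (fun T => G.f (u T) (v T)) atTop (𝓝 (G.f xs ys))) ∧
      (δ = 0 → ∀ xs ys, G.IsStackelbergEq 0 0 xs ys →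
        Tendsto (fun T => G.f (u T) (v T)) atTop (𝓝 (G.f xs ys)))) ∧
    (∃ N : ℝ → ℕ, (∃ C : ℝ, ∀ ε ∈ Ioo (0 : ℝ) 1, (N ε : ℝ) ≤ C * (ε ^ 2)⁻¹) ∧
      ∀ ε ∈ Ioo (0 : ℝ) 1, ∀ (δ : ℝ) (T : ℕ), N ε ≤ T →
      ∀ (x : ℕ → EuclideanSpace ℝ (Fin n)) (y : ℕ → EuclideanSpace ℝ (Fin m))
        (l : ℕ → Fin K → ℝ),
      ∀ xs ∈ G.X, (∀ z ∈ G.X, G.value xs ≤ G.value z) →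
        G.IsOracleDescent gradf gradg δ (fun _ => ‖x 0 - xs‖ / √(T : ℝ)) T x y l →
      ∃ Ts : ℕ, 1 ≤ Ts ∧ Ts ≤ T ∧
        ∀ u v, G.IsBestIterate x y Ts u v → G.IsStackelbergEq ε δ u v) := by
  constructor
  · intro δ η hη hsq hsum x y l hr u v hb
    obtain ⟨xs, ys, heq, hlim⟩ := hG.exists_isStackelbergEq_tendsto hL hη hsq hsum hr hb
    have hvalue := StackelbergGame.stackelbergValue_le hG.feasible_nonempty heq.mem_X
    refine ⟨⟨xs, ys, heq, (sub_le_sub_right hvalue δ).trans heq.inner_le, ?_, hlim⟩, ?_⟩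
    · simpa only [add_zero] using heq.outer_le
    · rintro rfl zs ws hzw
      rwa [hzw.f_eq_stackelbergValue hG.feasible_nonempty,
        ← heq.f_eq_stackelbergValue hG.feasible_nonempty]
  · obtain ⟨N, hNC, hN⟩ :=
      exists_nat_le_mul_inv_sq_forall_div_sqrt_le (Metric.diam G.X * (1 + L) ^ 2)
    refine ⟨N, hNC, fun ε hε δ T hNT x y l xs hxs hmin hr => ?_⟩
    obtain ⟨hT, hrate⟩ := hN ε hε T hNT
    have hdiam : ‖x 0 - xs‖ ≤ Metric.diam G.X :=
      dist_eq_norm (x 0) xs ▸ Metric.dist_le_diam_of_mem G.X_compact.isBounded hr.init hxs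
    exact ⟨T, one_le_two.trans hT, le_rfl, fun u v hb =>
      (hr.isStackelbergEq_of_isBestIterate hG hL hT hxs hmin hb).mono
        (le_trans (by gcongr) hrate)⟩

theorem mainTheorem2 {n m K : ℕ} (G : StackelbergGame n m K) (hX : Convex ℝ G.X)
    (gradf : EuclideanSpace ℝ (Fin n) → EuclideanSpace ℝ (Fin m) → EuclideanSpace ℝ (Fin n))
    (gradg : Fin K → EuclideanSpace ℝ (Fin n) → EuclideanSpace ℝ (Fin m) →
      EuclideanSpace ℝ (Fin n))
    (hG : G.MainAssumption gradf gradg) :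
    -- convergence for square-summable, non-summable step sizes
    (∀ (δ : ℝ) (η : ℕ → ℝ), 0 ≤ δ → (∀ t, 0 ≤ η t) → Summable (fun t => η t ^ 2) →
      Tendsto (fun T : ℕ => ∑ t ∈ Finset.Icc 1 T, η t) atTop atTop →
      ∀ (x : ℕ → EuclideanSpace ℝ (Fin n)) (y : ℕ → EuclideanSpace ℝ (Fin m))
        (l : ℕ → Fin K → ℝ), (∀ T, G.IsMOGDRun gradf gradg δ η T x y l) →
      ∀ (u : ℕ → EuclideanSpace ℝ (Fin n)) (v : ℕ → EuclideanSpace ℝ (Fin m)),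
        (∀ t, 1 ≤ t → G.IsBestIterate x y t (u t) (v t)) →
      (∃ xs ys, G.IsStackelbergEq 0 δ xs ys ∧
        G.stackelbergValue - δ ≤ G.f xs ys ∧ G.f xs ys ≤ G.stackelbergValue ∧
        Tendsto (fun T => G.f (u T) (v T)) atTop (𝓝 (G.f xs ys))) ∧
      (δ = 0 → ∀ xs ys, G.IsStackelbergEq 0 0 xs ys →
        Tendsto (fun T => G.f (u T) (v T)) atTop (𝓝 (G.f xs ys)))) ∧
    -- iteration complexity `O(ε⁻²)` with step size `‖x⁽⁰⁾ - x*‖ / √T`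
    (∃ N : ℝ → ℕ, (∃ C : ℝ, ∀ ε ∈ Ioo (0 : ℝ) 1, (N ε : ℝ) ≤ C * (ε ^ 2)⁻¹) ∧
      ∀ ε ∈ Ioo (0 : ℝ) 1, ∀ δ : ℝ, 0 ≤ δ → ∀ T : ℕ, N ε ≤ T →
      ∀ (x : ℕ → EuclideanSpace ℝ (Fin n)) (y : ℕ → EuclideanSpace ℝ (Fin m))
        (l : ℕ → Fin K → ℝ),
      ∀ xs ∈ G.X, (∀ z ∈ G.X, G.value xs ≤ G.value z) →
        G.IsMOGDRun gradf gradg δ (fun _ => ‖x 0 - xs‖ / √(T : ℝ)) T x y l →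
      ∃ Ts : ℕ, 1 ≤ Ts ∧ Ts ≤ T ∧
        ∀ u v, G.IsBestIterate x y Ts u v → G.IsStackelbergEq ε δ u v) := by
  obtain ⟨L, hL⟩ := hG.exists_norm_gradf_le
  obtain ⟨hlim, N, hNC, hN⟩ := mainTheorem2_general G hG.uncoupledAssumption hL
  exact ⟨fun δ η _ hη hsq hsum x y l hr =>
      hlim δ η hη hsq hsum x y l fun T => (hr T).isOracleDescent,
    N, hNC, fun ε hε δ _ T hT x y l xs hxs hmin hr =>
      hN ε hε δ T hT x y l xs hxs hmin hr.isOracleDescent⟩
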